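/- Let $R$ be a real closed field, i.e. a (totally) ordered field in which the intermediate value theorem holds for polynomials. For $P,Q\in R[X]$, let $\mathrm{sremp}(P,Q)$ be the signed pseudo-remainder sequence: the finite list of the nonzero polynomials $R_0=P$, $R_1=Q$, $R_{i+2}=-\big((\alpha_i R_i)\bmod R_{i+1}\big)$ (stopped before the first zero term; empty if $P=0$), where $\bmod$ is the remainder of Euclidean division and $\alpha_i=\mathrm{lc}(R_{i+1})^{2\max(0,\deg R_i+1-\deg R_{i+1})}>0$. For a finite list of elements of $R$, let $\mathrm{var}$ be its number of sign changes: zeroes are skipped and the pairs of consecutive elements with opposite signs are counted. Put $$\mathrm{var\_sremp}(a,b,P,Q)=\mathrm{var}\big(S(a)\big)_{S\in \mathrm{sremp}(P,Q)}-\mathrm{var}\big(S(b)\big)_{S\in \mathrm{sremp}(P,Q)}\in\mathbb Z .$$ Let $$\mathrm{ctmat1}=\begin{pmatrix}1&1&1\\-1&1&1\\0&0&1\end{pmatrix},$$ with rows indexed by the signs $1,-1,0$ and columns by the exponents $1,2,0$, in these orders. Let $n\ge 0$ and let $\mathrm{ctmat1}^{\otimes n}$ be its $n$-th tensor (Kronecker)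 power, which is invertible over $\mathbb Q$. For $\varepsilon\in\{0,1,2\}^n$ let $\lambda_\varepsilon\in\mathbb Q$ be the entry of the first column (the one for the signs $(1,\dots,1)$) of $(\mathrm{ctmat1}^{\otimes n})^{-1}$ in the row for the exponents $\varepsilon$. For $P,Q_1,\dots,Q_n\in R[X]$ and $b\in R$ put $$E(b,P,Q)=\sum_{\varepsilon\in\{0,1,2\}^n}\lambda_\varepsilon\cdot \mathrm{var\_sremp}\Big(-b,\,b,\,P,\;P'\cdot\prod_{k=1}^n Q_k^{\varepsilon_k}\Big)\in\mathbb Q .$$ (1) Let $P$ be monic and $Q_1,\dots,Q_n\in R[X]$. Call $b\in R$ admissible if $b$ is greater than the Cauchy bound of $P$ (the sum of the absolute values of the coefficients of $P$ divided by the absolute value of its leading coefficient) and $b$ is not a root of any polynomial in any of the sequences $\mathrm{sremp}(P,P'\prod_k Q_k^{\varepsilon_k})$, $\varepsilon\in\{0,1,2\}^n$. Then admissible points exist, and for every admissible $b$ $$\exists x\in R,\ P(x)=0\wedge\bigwedge_{k=1}^n Q_k(x)>0\quad\Longleftrightarrow\quad E(b,P,Q)>0 .$$ (2) The decision is expressed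 by sign conditions on polynomial expressions in the coefficients only. For all $n,d,e$ there are quantifier-free formulas $\Psi$ and $\Phi$, Boolean combinations of conditions $f>0$ and $f=0$ where $f$ is a polynomial with integer coefficients whose variables stand for the coefficients of $P,Q_1,\dots,Q_n$ (and, in $\Psi$, one more variable stands for $b$), such that for every real closed field $R$, every monic $P\in R[X]$ of degree $d$ and all $Q_1,\dots,Q_n\in R[X]$ of degree at most $e$: for every $b\in R$, $E(b,P,Q)>0$ holds iff $\Psi$ holds at $b$ and the coefficients of $P,Q_1,\dots,Q_n$; and $\exists x\in R,\ P(x)=0\wedge\bigwedge_k Q_k(x)>0$ holds iff $\Phi$ holds at the coefficients of $P,Q_1,\dots,Q_n$. -/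

import Mathlib

open Polynomial

universe u

/-- A (discrete) real closed field: an ordered field in which the intermediate value theorem
holds for polynomials. -/
class OrderedRealClosed (R : Type u) [Field R] [LinearOrder R] [IsStrictOrderedRing R] :
    Prop where
  ivt : ∀ (p : R[X]) (a b : R), a ≤ b → (0 : R) ∈ Set.Icc (p.eval a) (p.eval b) →
    ∃ x ∈ Set.Icc a b, p.IsRoot x

namespace TarskiQuery

section Remainders

variable {R : Type u} [Field R]

/-- The multiplier used for the pseudo-division of `p` by `q`. It is an even power of the leading
coefficient of `q`, hence positive over an ordered field when `q ≠ 0`, and its exponent is large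
enough for the Euclidean division of `scal p q • p` by `q` to be carried out without dividing
coefficients. -/
noncomputable def scal (p q : R[X]) : R :=
  q.leadingCoeff ^ (2 * (p.natDegree + 1 - q.natDegree))

/-- The pseudo-remainder of `p` by `q`: the remainder in the Euclidean division of
`scal p q • p` by `q`. -/
noncomputable def pseudoMod (p q : R[X]) : R[X] :=
  (C (scal p q) * p) % q

theorem degree_neg_pseudoMod_lt (p : R[X]) {q : R[X]} (hq : q ≠ 0) :
    (-pseudoMod p q).degree < q.degree := by
  rw [degree_neg]
  exact EuclideanDomain.mod_lt _ hq

open Classical in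
/-- The signed pseudo-remainder sequence `p, q, -pseudoMod p q, …`, stopped before its first
zero term, for a nonzero `p`. -/
noncomputable def srempFrom (p q : R[X]) : List R[X] :=
  if q = 0 then [p] else p :: srempFrom q (-pseudoMod p q)
termination_by q.degree
decreasing_by exact degree_neg_pseudoMod_lt p (by assumption)

open Classical in
/-- The signed pseudo-remainder sequence of `P` and `Q`: `R₀ = P`, `R₁ = Q`,
`Rᵢ₊₂ = - pseudoMod Rᵢ Rᵢ₊₁`, made of its nonzero terms only; it is empty if `P = 0`. -/
noncomputable def sremp (P Q : R[X]) : List R[X] :=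
  if P = 0 then [] else srempFrom P Q

end Remainders

section Signs

variable {R : Type u} [Field R] [LinearOrder R]

/-- Number of pairs of neighbours with opposite strict signs. -/
def oppositeNeighbours : List R → ℕ
  | [] => 0
  | a :: s => (if a * s.headD 0 < 0 then 1 else 0) + oppositeNeighbours s

/-- Number of sign changes in a list of values: zeroes are skipped, then consecutive values of
distinct signs are counted. -/
def var (s : List R) : ℕ :=
  oppositeNeighbours (s.filter fun a => a ≠ 0)

/-- The number of sign changes at `a` minus the number of sign changes at `b`. -/
noncomputable def varp (a b : R) (s : List R[X]) : ℤ :=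
  (var (s.map fun p => p.eval a) : ℤ) - (var (s.map fun p => p.eval b) : ℤ)

noncomputable def varSremp (a b : R) (P Q : R[X]) : ℤ :=
  varp a b (sremp P Q)

/-- The sum of the absolute values of the coefficients divided by the absolute value of the
leading coefficient. -/
noncomputable def cauchyBound (P : R[X]) : R :=
  |P.leadingCoeff|⁻¹ * ∑ i ∈ Finset.range (P.natDegree + 1), |P.coeff i|

end Signs

/-- Rows correspond to the signs `1, -1, 0` and columns to the exponents `1, 2, 0`. -/
def ctmat1 : Matrix (Fin 3) (Fin 3) ℚ :=
  !![ 1, 1, 1;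
     -1, 1, 1;
      0, 0, 1]

/-- The `n`-th iterated tensor (Kronecker) power of `ctmat1`; the index set `{0, 1, 2}ⁿ⁺¹` is
identified with `{0, 1, 2} × {0, 1, 2}ⁿ`. -/
def ctmat : (n : ℕ) → Matrix (Fin n → Fin 3) (Fin n → Fin 3) ℚ
  | 0 => 1
  | n + 1 =>
      (Matrix.kroneckerMap (fun a b => a * b) ctmat1 (ctmat n)).submatrix
        (fun i => (i 0, Fin.tail i)) (fun j => (j 0, Fin.tail j))

/-- The position of an exponent in the enumeration `1, 2, 0`. -/
def expPos : Fin 3 → Fin 3 := ![2, 0, 1]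

/-- The coefficient `λ_ε`: the entry of the first column of the inverse of `ctmat n` in the row
that corresponds to the tuple of exponents `ε`. -/
noncomputable def lam {n : ℕ} (ε : Fin n → Fin 3) : ℚ :=
  (ctmat n)⁻¹ (fun k => expPos (ε k)) (fun _ => 0)

theorem isUnit_det_ctmat (n : ℕ) : IsUnit (ctmat n).det := by
  induction n with
  | zero => simp [ctmat]
  | succ n ih =>
    have h1 : ctmat1.det = 2 := by
      simp [ctmat1, Matrix.det_fin_three]; norm_num
    have h2 : ctmat (n + 1) = Matrix.submatrix
        (Matrix.kroneckerMap (fun a b => a * b) ctmat1 (ctmat n))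
        (Fin.consEquiv fun _ => Fin 3).symm (Fin.consEquiv fun _ => Fin 3).symm := rfl
    rw [h2, Matrix.det_submatrix_equiv_self, Matrix.det_kronecker, h1]
    exact ((IsUnit.mk0 _ (by norm_num)).pow _).mul (ih.pow _)

section Decision

variable {R : Type u} [Field R] [LinearOrder R] {n : ℕ}

/-- `P' * ∏ₖ Qₖ ^ εₖ`. -/
noncomputable def taqPoly (P : R[X]) (Q : Fin n → R[X]) (ε : Fin n → Fin 3) : R[X] :=
  derivative P * ∏ k, Q k ^ (ε k : ℕ)

/-- `b` is greater than the Cauchy bound of `P` and no polynomial of any of the remainder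
sequences of `P` and `P' * ∏ₖ Qₖ ^ εₖ` vanishes at `b`. -/
def IsAdmissibleBound (P : R[X]) (Q : Fin n → R[X]) (b : R) : Prop :=
  cauchyBound P < b ∧ ∀ ε : Fin n → Fin 3, ∀ S ∈ sremp P (taqPoly P Q ε), S.eval b ≠ 0

/-- `∑_ε λ_ε * varSremp (-b) b P (P' * ∏ₖ Qₖ ^ εₖ)`. -/
noncomputable def decisionSum (b : R) (P : R[X]) (Q : Fin n → R[X]) : ℚ :=
  ∑ ε : Fin n → Fin 3, lam ε * (varSremp (-b) b P (taqPoly P Q ε) : ℚ)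

end Decision

/-- Boolean combinations of sign conditions on polynomials with integer coefficients in the
variables `σ`. -/
inductive SignFormula (σ : Type) : Type
  | pos (p : MvPolynomial σ ℤ) : SignFormula σ
  | zero (p : MvPolynomial σ ℤ) : SignFormula σ
  | neg (φ : SignFormula σ) : SignFormula σ
  | and (φ ψ : SignFormula σ) : SignFormula σ
  | or (φ ψ : SignFormula σ) : SignFormula σ

/-- The truth value of a sign formula at the values `v` of its variables. -/
def SignFormula.Holds {σ : Type} {R : Type u} [Field R] [LinearOrder R] (v : σ → R) :
    SignFormula σ → Prop
  | .pos p => 0 < MvPolynomial.aeval v p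
  | .zero p => MvPolynomial.aeval v p = 0
  | .neg φ => ¬ φ.Holds v
  | .and φ ψ => φ.Holds v ∧ ψ.Holds v
  | .or φ ψ => φ.Holds v ∨ ψ.Holds v

/-- Variables for the coefficients of `P` and of `Q₁, …, Qₙ`. -/
inductive CoeffVar (n : ℕ) : Type
  | ofP (i : ℕ) : CoeffVar n
  | ofQ (k : Fin n) (i : ℕ) : CoeffVar n

/-- The values of the coefficient variables for given polynomials. -/
def coeffVal {R : Type u} [Field R] {n : ℕ} (P : R[X]) (Q : Fin n → R[X]) : CoeffVar n → R
  | .ofP i => P.coeff i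
  | .ofQ k i => (Q k).coeff i

/-- The values of the coefficient variables, and the value `b` for one further variable. -/
def boundCoeffVal {R : Type u} [Field R] {n : ℕ} (b : R) (P : R[X]) (Q : Fin n → R[X]) :
    Option (CoeffVar n) → R
  | none => b
  | some c => coeffVal P Q c

end TarskiQuery

/-! The sum E is the number of roots of P at which all Qₖ are positive (`decisionSum_eq_card`). By
the Sturm–Tarski theorem (`varSremp_derivative_mul`), the variation for P and P'·Q is the sum of the
signs of Q over the roots of P in the interval, and beyond the Cauchy bound the interval (-b, b)
contains every root. At a root, the sign of ∏ Qₖ^εₖ is an entry of `ctmat n`, in the row given by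
the signs of the Qₖ; weighting by the first column of the inverse leaves the indicator of the sign
vector (1, …, 1) (`sum_lam_mul_intSign`).

Sturm–Tarski is proved point by point. With r the signed pseudo-remainder of p by q, the doubled
jump of q/p at c is the change of sign of p·q at c plus the doubled jump of r/q
(`jump_eq_add_jump`). Iterating, it is the total change of sign at c of the products of neighbours
in the remainder sequence. By the intermediate value property these changes add up over an interval
to differences of end signs, which count variations (`two_mul_varSremp`). For q = P'·Q the doubled
jump at a root c of P is twice the sign of Q(c).

For the formulas, the remainder sequence is run once on polynomials with indeterminate coefficients,
branching on the vanishing of leading coefficients. Pseudo-division divides no coefficients, so one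
finite sign tree serves all fields. Ψ evaluates the remainders at ±b; for Φ, b lies beyond the
Cauchy bounds of all remainders, where signs at ±b follow from leading coefficients and degrees, and
b disappears. -/

namespace TarskiQuery

/-! ### One-sided signs and jumps at a point -/

section LocalSigns

variable {R : Type u} [Field R]

theorem exists_eq_pow_mul_eval_ne_zero {p : R[X]} (hp : p ≠ 0) (c : R) :
    ∃ g : R[X], p = (X - C c) ^ p.rootMultiplicity c * g ∧ g.eval c ≠ 0 :=
  ⟨_, (pow_mul_divByMonic_rootMultiplicity_eq p c).symm,
    eval_divByMonic_pow_rootMultiplicity_ne_zero c hp⟩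

theorem rootMultiplicity_pow_mul {g : R[X]} {c : R} (hg : g.eval c ≠ 0) (m : ℕ) :
    ((X - C c) ^ m * g).rootMultiplicity c = m := by
  have hg0 : g ≠ 0 := by rintro rfl; simp at hg
  rw [rootMultiplicity_mul (mul_ne_zero (pow_ne_zero _ (X_sub_C_ne_zero c)) hg0),
    rootMultiplicity_X_sub_C_pow, rootMultiplicity_eq_zero hg, add_zero]

/-- Signed pseudo-division. -/
theorem exists_neg_pseudoMod_eq (p q : R[X]) :
    ∃ w : R[X], -pseudoMod p q = w * q - C (scal p q) * p := by
  refine ⟨(C (scal p q) * p) / q, ?_⟩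
  have := EuclideanDomain.div_add_mod (C (scal p q) * p) q
  rw [pseudoMod]
  linear_combination -this

variable [LinearOrder R]

/-- The sign of an element, as an integer. -/
def intSign (x : R) : ℤ := (SignType.sign x : ℤ)

theorem intSign_of_pos {x : R} (h : 0 < x) : intSign x = 1 := by simp [intSign, h]

theorem intSign_of_neg {x : R} (h : x < 0) : intSign x = -1 := by simp [intSign, h]

@[simp] theorem intSign_zero : intSign (0 : R) = 0 := by simp [intSign]

/-- The sign of `p` immediately to the right of `c`. -/
noncomputable def rightSign (p : R[X]) (c : R) : ℤ :=
  intSign ((p /ₘ (X - C c) ^ p.rootMultiplicity c).eval c)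

/-- The sign of `p` immediately to the left of `c`. -/
noncomputable def leftSign (p : R[X]) (c : R) : ℤ :=
  (-1) ^ p.rootMultiplicity c * rightSign p c

/-- Twice the jump at `c` of the rational function `q / p`. -/
noncomputable def jump (p q : R[X]) (c : R) : ℤ :=
  if q.rootMultiplicity c < p.rootMultiplicity c then
    rightSign (p * q) c - leftSign (p * q) c else 0

theorem rightSign_pow_mul {g : R[X]} {c : R} (hg : g.eval c ≠ 0) (m : ℕ) :
    rightSign ((X - C c) ^ m * g) c = intSign (g.eval c) := by
  rw [rightSign, rootMultiplicity_pow_mul hg,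
    mul_divByMonic_cancel_left _ ((monic_X_sub_C c).pow m)]

theorem leftSign_pow_mul {g : R[X]} {c : R} (hg : g.eval c ≠ 0) (m : ℕ) :
    leftSign ((X - C c) ^ m * g) c = (-1) ^ m * intSign (g.eval c) := by
  rw [leftSign, rootMultiplicity_pow_mul hg, rightSign_pow_mul hg]

theorem rightSign_of_eval_ne_zero {p : R[X]} {c : R} (h : p.eval c ≠ 0) :
    rightSign p c = intSign (p.eval c) := by
  simpa using rightSign_pow_mul h 0

@[simp] theorem rightSign_zero (c : R) : rightSign (0 : R[X]) c = 0 := by simp [rightSign]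

@[simp] theorem leftSign_zero (c : R) : leftSign (0 : R[X]) c = 0 := by simp [leftSign]

@[simp] theorem jump_zero_right (p : R[X]) (c : R) : jump p 0 c = 0 := by simp [jump]

variable [IsStrictOrderedRing R]

theorem intSign_mul (x y : R) : intSign (x * y) = intSign x * intSign y := by
  simp [intSign, sign_mul]

theorem intSign_pow (x : R) (m : ℕ) : intSign (x ^ m) = intSign x ^ m := by
  induction m with
  | zero => simp [intSign]
  | succ m ih => rw [pow_succ, intSign_mul, ih, pow_succ]

theorem intSign_neg (x : R) : intSign (-x) = -intSign x := by
  rw [← neg_one_mul, intSign_mul, intSign_of_neg (by simp : (-1 : R) < 0), neg_one_mul]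

theorem intSign_mul_self {x : R} (h : x ≠ 0) : intSign x * intSign x = 1 := by
  rw [← intSign_mul, intSign_of_pos (mul_self_pos.mpr h)]

theorem rightSign_mul (p q : R[X]) (c : R) :
    rightSign (p * q) c = rightSign p c * rightSign q c := by
  rcases eq_or_ne p 0 with rfl | hp
  · simp
  rcases eq_or_ne q 0 with rfl | hq
  · simp
  obtain ⟨g, hpg, hg⟩ := exists_eq_pow_mul_eval_ne_zero hp c
  obtain ⟨h, hqh, hh⟩ := exists_eq_pow_mul_eval_ne_zero hq c
  rw [hpg, hqh, mul_mul_mul_comm, ← pow_add, rightSign_pow_mul hg, rightSign_pow_mul hh,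
    rightSign_pow_mul (by rw [eval_mul]; exact mul_ne_zero hg hh), eval_mul, intSign_mul]

theorem scal_pos (p : R[X]) {q : R[X]} (hq : q ≠ 0) : 0 < scal p q :=
  (even_two_mul _).pow_pos (leadingCoeff_ne_zero.mpr hq)

/-- Inversion formula for the Cauchy index. Let m and k be the multiplicities of c in p and q. If k
≤ m, then (X - c)^k divides the remainder, so the second jump vanishes; for k = m, moreover, p·q has
even multiplicity and does not change sign. If m < k, the remainder behaves like -αp near c with α >
0, and the two terms on the right cancel. -/
theorem jump_eq_add_jump {p q : R[X]} (hp : p ≠ 0) (hq : q ≠ 0) (c : R) :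
    jump p q c = (rightSign (p * q) c - leftSign (p * q) c) + jump q (-pseudoMod p q) c := by
  obtain ⟨w, hw⟩ := exists_neg_pseudoMod_eq p q
  have hα := scal_pos p hq
  obtain ⟨g, hpg, hg⟩ := exists_eq_pow_mul_eval_ne_zero hp c
  obtain ⟨h, hqh, hh⟩ := exists_eq_pow_mul_eval_ne_zero hq c
  set r := -pseudoMod p q with hr
  set α := scal p q with hα'
  set m := p.rootMultiplicity c with hm
  set k := q.rootMultiplicity c with hk
  have hpq : p * q = (X - C c) ^ (m + k) * (g * h) := by
    conv_lhs => rw [hpg, hqh]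
    ring
  have hgh : (g * h).eval c ≠ 0 := by rw [eval_mul]; exact mul_ne_zero hg hh
  rcases le_or_gt k m with hkm | hmk
  · have h2 : jump q r c = 0 := by
      rcases eq_or_ne r 0 with h0 | h0
      · rw [h0, jump_zero_right]
      · refine if_neg (not_lt.mpr ((le_rootMultiplicity_iff h0).mpr ?_))
        rw [hw]
        refine dvd_sub (Dvd.dvd.mul_left ⟨h, hqh⟩ _) (Dvd.dvd.mul_left ?_ _)
        exact (pow_dvd_pow _ hkm).trans ⟨g, hpg⟩
    rw [h2, add_zero]
    rcases hkm.lt_or_eq with h | h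
    · exact if_pos h
    · rw [jump, if_neg (by rw [← hk, ← hm, h]; exact lt_irrefl _), hpq, rightSign_pow_mul hgh,
        leftSign_pow_mul hgh, h, Even.neg_one_pow ⟨m, rfl⟩, one_mul, sub_self]
  · obtain ⟨t, ht⟩ : ∃ t : R[X], t = w * ((X - C c) ^ (k - m) * h) - C α * g := ⟨_, rfl⟩
    have hrt : r = (X - C c) ^ m * t := by
      have : (X - C c) ^ k = (X - C c) ^ m * (X - C c) ^ (k - m) := by
        rw [← pow_add, Nat.add_sub_cancel' hmk.le]
      rw [hw, ht]
      conv_lhs => rw [hpg, hqh, this]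
      ring
    have htc : t.eval c = -(α * g.eval c) := by
      simp [ht, zero_pow (Nat.sub_ne_zero_of_lt hmk)]
    have htc0 : t.eval c ≠ 0 := by rw [htc]; exact neg_ne_zero.mpr (mul_ne_zero hα.ne' hg)
    have hrm : r.rootMultiplicity c = m := by rw [hrt, rootMultiplicity_pow_mul htc0]
    have hqr : q * r = (X - C c) ^ (m + k) * (t * h) := by
      conv_lhs => rw [hrt, hqh]
      ring
    have hth : (t * h).eval c ≠ 0 := by rw [eval_mul]; exact mul_ne_zero htc0 hh
    have hs : intSign ((t * h).eval c) = -intSign ((g * h).eval c) := by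
      rw [eval_mul, eval_mul, htc, intSign_mul, intSign_neg, intSign_mul, intSign_of_pos hα,
        intSign_mul]
      ring
    rw [jump, jump, if_neg (by rw [← hk, ← hm]; exact hmk.not_gt),
      if_pos (by rw [hrm, ← hk]; exact hmk), hpq, hqr, rightSign_pow_mul hgh,
      leftSign_pow_mul hgh, rightSign_pow_mul hth, leftSign_pow_mul hth, hs]
    ring

end LocalSigns

/-! ### Sign changes along an interval -/

section Telescoping

variable {R : Type u} [Field R] [LinearOrder R] [IsStrictOrderedRing R] [OrderedRealClosed R]

theorem intSign_eval_eq_of_no_root {p : R[X]} {a b : R} (hab : a ≤ b)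
    (h : ∀ x ∈ Set.Icc a b, p.eval x ≠ 0) : intSign (p.eval a) = intSign (p.eval b) := by
  have key : ∀ q : R[X], (∀ x ∈ Set.Icc a b, q.eval x ≠ 0) →
      ¬ (q.eval a ≤ 0 ∧ 0 ≤ q.eval b) := fun q hq hs => by
    obtain ⟨x, hx, hx0⟩ := OrderedRealClosed.ivt q a b hab hs
    exact hq x hx hx0
  have h1 := key p h
  have h2 := key (-p) (by simpa using h)
  simp only [eval_neg] at h2
  rcases lt_or_gt_of_ne (h a ⟨le_rfl, hab⟩) with ha | ha <;>
  rcases lt_or_gt_of_ne (h b ⟨hab, le_rfl⟩) with hb | hb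
  · rw [intSign_of_neg ha, intSign_of_neg hb]
  · exact absurd ⟨ha.le, hb.le⟩ h1
  · exact absurd ⟨by linarith, by linarith⟩ h2
  · rw [intSign_of_pos ha, intSign_of_pos hb]

/-- Since p may vanish at a itself, (X - a)^m is divided out first; it is positive at b, and the
cofactor has no root in [a, b]. -/
theorem rightSign_eq_intSign_eval {p : R[X]} {a b : R} (hab : a < b)
    (h : ∀ x ∈ Set.Ioc a b, p.eval x ≠ 0) : rightSign p a = intSign (p.eval b) := by
  have hp : p ≠ 0 := by rintro rfl; exact h b ⟨hab, le_rfl⟩ eval_zero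
  obtain ⟨g, hpg, hg⟩ := exists_eq_pow_mul_eval_ne_zero hp a
  rw [hpg, rightSign_pow_mul hg]
  have hb : 0 < ((X - C a) ^ p.rootMultiplicity a).eval b := by
    simpa using pow_pos (sub_pos.mpr hab) _
  rw [eval_mul, intSign_mul, intSign_of_pos hb, one_mul]
  apply intSign_eval_eq_of_no_root hab.le
  intro x hx hx0
  rcases hx.1.eq_or_lt with rfl | hax
  · exact hg hx0
  · exact h x ⟨hax, hx.2⟩ (by rw [hpg, eval_mul, hx0, mul_zero])

theorem leftSign_eq_intSign_eval {p : R[X]} {a b : R} (hab : a < b)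
    (h : ∀ x ∈ Set.Ico a b, p.eval x ≠ 0) : leftSign p b = intSign (p.eval a) := by
  have hp : p ≠ 0 := by rintro rfl; exact h a ⟨le_rfl, hab⟩ eval_zero
  obtain ⟨g, hpg, hg⟩ := exists_eq_pow_mul_eval_ne_zero hp b
  rw [hpg, leftSign_pow_mul hg]
  have ha : (X - C b).eval a < 0 := by simpa using hab
  rw [eval_mul, intSign_mul, eval_pow, intSign_pow, intSign_of_neg ha]
  congr 1
  symm
  apply intSign_eval_eq_of_no_root hab.le
  intro x hx hx0
  rcases hx.2.eq_or_lt with rfl | hax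
  · exact hg hx0
  · exact h x ⟨hx.1, hax⟩ (by rw [hpg, eval_mul, hx0, mul_zero])

/-- The change of sign of `p` between `a` and `b` is the sum of its changes at its roots. -/
theorem leftSign_sub_rightSign_eq_sum {p : R[X]} (Z : Finset R) :
    ∀ {a b : R}, a < b → (∀ x ∈ Z, a < x ∧ x < b) →
      (∀ x, a < x → x < b → p.eval x = 0 → x ∈ Z) →
      leftSign p b - rightSign p a = ∑ c ∈ Z, (rightSign p c - leftSign p c) := by
  induction Z using Finset.strongInduction with
  | H Z ih =>
    intro a b hab hZ hroot
    rcases Z.eq_empty_or_nonempty with rfl | ⟨c, hc⟩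
    -- Without roots inside, both one-sided signs equal the sign at an interior point.
    · have hmid := exists_between hab
      obtain ⟨m, ham, hmb⟩ := hmid
      rw [leftSign_eq_intSign_eval hmb fun x hx hx0 =>
          Finset.notMem_empty x (hroot x (ham.trans_le hx.1) hx.2 hx0),
        rightSign_eq_intSign_eval ham fun x hx hx0 =>
          Finset.notMem_empty x (hroot x hx.1 (hx.2.trans_lt hmb) hx0)]
      simp
    -- Splitting at c: the two halves contribute `leftSign p c - rightSign p a` and `leftSign p b -
    -- rightSign p c`, and the summand at c bridges them.
    · obtain ⟨hac, hcb⟩ := hZ c hc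
      have h1 := ih (Z.filter (· < c)) (Finset.filter_ssubset.mpr ⟨c, hc, lt_irrefl c⟩) hac
        (fun x hx => ⟨(hZ x (Finset.mem_filter.mp hx).1).1, (Finset.mem_filter.mp hx).2⟩)
        (fun x hx hx' h0 => Finset.mem_filter.mpr ⟨hroot x hx (hx'.trans hcb) h0, hx'⟩)
      have h2 := ih (Z.filter (c < ·)) (Finset.filter_ssubset.mpr ⟨c, hc, lt_irrefl c⟩) hcb
        (fun x hx => ⟨(Finset.mem_filter.mp hx).2, (hZ x (Finset.mem_filter.mp hx).1).2⟩)
        (fun x hx hx' h0 => Finset.mem_filter.mpr ⟨hroot x (hac.trans hx) hx' h0, hx⟩)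
      have h3 : Z = insert c (Z.filter (· < c) ∪ Z.filter (c < ·)) := by
        ext x
        simp only [Finset.mem_insert, Finset.mem_union, Finset.mem_filter]
        constructor
        · intro hx
          rcases lt_trichotomy x c with h | h | h <;> simp [hx, h]
        · rintro (rfl | h | h)
          exacts [hc, h.1, h.1]
      rw [h3, Finset.sum_insert (by simp), Finset.sum_union, ← h1, ← h2]
      · ring
      · rw [Finset.disjoint_filter]
        exact fun x _ h => h.not_gt

end Telescoping

/-! ### Variations along the remainder sequence as sums of jumps -/

section Sequences

variable {R : Type u} [Field R]

theorem srempFrom_zero (p : R[X]) : srempFrom p 0 = [p] := by rw [srempFrom, if_pos rfl]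

theorem srempFrom_of_ne_zero (p : R[X]) {q : R[X]} (hq : q ≠ 0) :
    srempFrom p q = p :: srempFrom q (-pseudoMod p q) := by rw [srempFrom, if_neg hq]

theorem exists_srempFrom_eq_cons (p q : R[X]) : ∃ l, srempFrom p q = p :: l := by
  rcases eq_or_ne q 0 with rfl | hq
  · exact ⟨_, srempFrom_zero p⟩
  · exact ⟨_, srempFrom_of_ne_zero p hq⟩

theorem ne_zero_of_mem_srempFrom {p : R[X]} (q : R[X]) (hp : p ≠ 0) :
    ∀ f ∈ srempFrom p q, f ≠ 0 := by
  induction p, q using srempFrom.induct with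
  | case1 p => simpa [srempFrom_zero] using hp
  | case2 p q hq ih =>
    rw [srempFrom_of_ne_zero p hq]
    exact List.forall_mem_cons.mpr ⟨hp, ih hq⟩

theorem ne_zero_of_mem_sremp {P Q : R[X]} : ∀ f ∈ sremp P Q, f ≠ 0 := by
  rw [sremp]
  split_ifs with h
  · simp
  · exact ne_zero_of_mem_srempFrom Q h

/-- The products of consecutive terms of a list. -/
noncomputable def neighbourProducts (l : List R[X]) : List R[X] := List.zipWith (fun p q => p * q) l l.tail

theorem neighbourProducts_cons_cons (p q : R[X]) (l : List R[X]) :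
    neighbourProducts (p :: q :: l) = p * q :: neighbourProducts (q :: l) := rfl

theorem neighbourProducts_srempFrom_zero (p : R[X]) :
    neighbourProducts (srempFrom p 0) = [] := by
  rw [srempFrom_zero]; rfl

theorem neighbourProducts_srempFrom (p : R[X]) {q : R[X]} (hq : q ≠ 0) :
    neighbourProducts (srempFrom p q) =
      p * q :: neighbourProducts (srempFrom q (-pseudoMod p q)) := by
  obtain ⟨l, hl⟩ := exists_srempFrom_eq_cons q (-pseudoMod p q)
  rw [srempFrom_of_ne_zero p hq, hl, neighbourProducts_cons_cons]

theorem ne_zero_of_mem_neighbourProducts {p : R[X]} (q : R[X]) (hp : p ≠ 0) :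
    ∀ f ∈ neighbourProducts (srempFrom p q), f ≠ 0 := by
  induction p, q using srempFrom.induct with
  | case1 p => simp [neighbourProducts_srempFrom_zero]
  | case2 p q hq ih =>
    rw [neighbourProducts_srempFrom p hq]
    exact List.forall_mem_cons.mpr ⟨mul_ne_zero hp hq, ih hq⟩

variable [LinearOrder R] [IsStrictOrderedRing R]

theorem sum_rightSign_sub_leftSign {p : R[X]} (q : R[X]) (hp : p ≠ 0) (c : R) :
    ((neighbourProducts (srempFrom p q)).map fun f => rightSign f c - leftSign f c).sum =
      jump p q c := by
  induction p, q using srempFrom.induct with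
  | case1 p => simp [neighbourProducts_srempFrom_zero]
  | case2 p q hq ih =>
    rw [neighbourProducts_srempFrom p hq, List.map_cons, List.sum_cons, ih hq,
      ← jump_eq_add_jump hp hq]

omit [IsStrictOrderedRing R] in
theorem var_cons_zero (a : R) (l : List R) : var (a :: 0 :: l) = var (a :: l) := by
  simp [var, List.filter_cons]

omit [IsStrictOrderedRing R] in
theorem var_cons_cons {a b : R} (ha : a ≠ 0) (hb : b ≠ 0) (l : List R) :
    var (a :: b :: l) = (if a * b < 0 then 1 else 0) + var (b :: l) := by
  simp [var, ha, hb, oppositeNeighbours]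

theorem two_mul_ite_neg {a b : R} (ha : a ≠ 0) (hb : b ≠ 0) :
    2 * (if a * b < 0 then 1 else 0 : ℤ) = 1 - intSign (a * b) := by
  rcases lt_or_gt_of_ne (mul_ne_zero ha hb) with h | h
  · rw [if_pos h, intSign_of_neg h]; rfl
  · rw [if_neg h.not_gt, intSign_of_pos h]; rfl

/-- If `p` does not vanish at `c`, the number of sign changes at `c` is the number of sign
changes immediately to the right of `c`. -/
theorem two_mul_var_srempFrom {p : R[X]} (q : R[X]) {c : R} (hp : p.eval c ≠ 0) :
    2 * (var ((srempFrom p q).map fun f => f.eval c) : ℤ) =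
      ((neighbourProducts (srempFrom p q)).map fun f => 1 - rightSign f c).sum := by
  -- When q(c) = 0 the induction must skip to the pair after (q, r), so the claim is carried for two
  -- consecutive pairs at once.
  suffices H : ∀ p q : R[X], (p.eval c ≠ 0 →
      2 * (var ((srempFrom p q).map fun f => f.eval c) : ℤ) =
        ((neighbourProducts (srempFrom p q)).map fun f => 1 - rightSign f c).sum) ∧ ((q.eval c ≠ 0 →
      2 * (var ((srempFrom q (-pseudoMod p q)).map fun f => f.eval c) : ℤ) =
      ((neighbourProducts (srempFrom q (-pseudoMod p q))).map
        fun f => 1 - rightSign f c).sum)) from (H p q).1 hp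
  clear hp p q
  intro p q
  induction p, q using srempFrom.induct with
  | case1 p =>
    refine ⟨fun hp => ?_, fun h => absurd eval_zero h⟩
    rw [neighbourProducts_srempFrom_zero, srempFrom_zero]
    simp [var, hp, oppositeNeighbours]
  | case2 p q hq ih =>
    refine ⟨fun hp => ?_, ih.1⟩
    rw [neighbourProducts_srempFrom p hq, srempFrom_of_ne_zero p hq, List.map_cons, List.map_cons,
      List.sum_cons]
    rcases eq_or_ne (q.eval c) 0 with hqc | hqc
    -- Here r(c) = -α p(c) with α > 0: skipping the zero leaves exactly one sign change. On the
    -- other side, p·q and q·r have opposite right signs, so their two terms add up to 2.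
    · obtain ⟨w, hw⟩ := exists_neg_pseudoMod_eq p q
      set r := -pseudoMod p q
      have hα := scal_pos p hq
      have hrc : r.eval c = -(scal p q * p.eval c) := by rw [hw]; simp [hqc]
      have hrc0 : r.eval c ≠ 0 := by
        rw [hrc]; exact neg_ne_zero.mpr (mul_ne_zero hα.ne' hp)
      have hr : r ≠ 0 := by rintro h; rw [h] at hrc0; exact hrc0 eval_zero
      obtain ⟨l, hl⟩ := exists_srempFrom_eq_cons r (-pseudoMod q r)
      have h2 := ih.2 hrc0
      rw [neighbourProducts_srempFrom q hr, srempFrom_of_ne_zero q hr, List.map_cons,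
        List.map_cons, List.sum_cons, hqc, var_cons_zero, ← h2, hl, List.map_cons,
        var_cons_cons hp hrc0, rightSign_mul, rightSign_mul, rightSign_of_eval_ne_zero hp,
        rightSign_of_eval_ne_zero hrc0, hrc, intSign_neg, intSign_mul, intSign_of_pos hα, if_pos]
      · push_cast; ring
      · have : 0 < scal p q * (p.eval c * p.eval c) := mul_pos hα (mul_self_pos.mpr hp)
        linarith
    · obtain ⟨l, hl⟩ := exists_srempFrom_eq_cons q (-pseudoMod p q)
      rw [← ih.1 hqc, hl, List.map_cons, var_cons_cons hp hqc,
        rightSign_of_eval_ne_zero (by rw [eval_mul]; exact mul_ne_zero hp hqc), eval_mul,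
        ← two_mul_ite_neg hp hqc]
      push_cast
      ring

variable [OrderedRealClosed R]

theorem sum_map_eq_finsetSum {α β : Type*} (l : List α) (Z : Finset β) {F G : α → ℤ}
    (H : α → β → ℤ) (h : ∀ f ∈ l, F f - G f = ∑ c ∈ Z, H f c) :
    (l.map F).sum - (l.map G).sum = ∑ c ∈ Z, (l.map fun f => H f c).sum := by
  induction l with
  | nil => simp
  | cons f l ih =>
    obtain ⟨h1, h2⟩ := List.forall_mem_cons.mp h
    simp only [List.map_cons, List.sum_cons, Finset.sum_add_distrib, ← h1, ← ih h2]
    ring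

theorem two_mul_varSremp {p : R[X]} (q : R[X]) {a b : R} (hab : a < b) (ha : p.eval a ≠ 0)
    (hb : p.eval b ≠ 0) :
    2 * varSremp a b p q =
      ∑ c ∈ p.roots.toFinset.filter fun c => a < c ∧ c < b, jump p q c := by
  have hp : p ≠ 0 := by rintro rfl; exact ha eval_zero
  obtain ⟨L, hL⟩ : ∃ L, L = neighbourProducts (srempFrom p q) := ⟨_, rfl⟩
  have hL0 : L.prod ≠ 0 := List.prod_ne_zero fun h =>
    ne_zero_of_mem_neighbourProducts q hp 0 (hL ▸ h) rfl
  -- Z is one set of points serving all products of neighbours; the extra points that are not roots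
  -- of p have jump 0.
  set Z := (p * L.prod).roots.toFinset.filter fun c => a < c ∧ c < b with hZ
  have hroot : ∀ f ∈ L, ∀ x, a < x → x < b → f.eval x = 0 → x ∈ Z := by
    intro f hf x hax hxb hx
    simp only [hZ, Finset.mem_filter, Multiset.mem_toFinset, mem_roots (mul_ne_zero hp hL0)]
    refine ⟨?_, hax, hxb⟩
    exact IsRoot.dvd hx ((List.dvd_prod hf).mul_left p)
  have h1 := two_mul_var_srempFrom q ha
  have h2 := two_mul_var_srempFrom q hb
  have h3 := sum_rightSign_sub_leftSign q hp b
  have hjump : ∀ c, p.eval c ≠ 0 → jump p q c = 0 := fun c hc => by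
    rw [jump, rootMultiplicity_eq_zero hc, if_neg (Nat.not_lt_zero _)]
  -- Telescoping yields left signs at b, while variations are expressed by right signs. As p(b) ≠ 0,
  -- the jump at b is 0 and the two sums agree, even if later remainders vanish at b.
  rw [hjump b hb] at h3
  have h4 := sum_map_eq_finsetSum L Z (F := fun f => leftSign f b) (G := fun f => rightSign f a)
    (fun f c => rightSign f c - leftSign f c) fun f hf =>
      leftSign_sub_rightSign_eq_sum Z hab (fun x hx => (Finset.mem_filter.mp hx).2) (hroot f hf)
  simp only [hL, sum_rightSign_sub_leftSign q hp] at h4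
  have h5 : ∑ c ∈ Z, jump p q c =
      ∑ c ∈ p.roots.toFinset.filter fun c => a < c ∧ c < b, jump p q c := by
    symm
    apply Finset.sum_subset
    · intro x hx
      simp only [hZ, Finset.mem_filter, Multiset.mem_toFinset, mem_roots (mul_ne_zero hp hL0),
        mem_roots hp] at hx ⊢
      exact ⟨IsRoot.dvd hx.1 (dvd_mul_right _ _), hx.2⟩
    · intro x hx hx'
      apply hjump
      intro h0
      exact hx' (Finset.mem_filter.mpr ⟨by simpa [hp] using h0, (Finset.mem_filter.mp hx).2⟩)
  have h6 : ∀ (l : List R[X]) (F G : R[X] → ℤ),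
      (l.map fun f => F f - G f).sum = (l.map F).sum - (l.map G).sum := fun l F G => by
    induction l with
    | nil => simp
    | cons f l ih => simp only [List.map_cons, List.sum_cons, ih]; ring
  rw [← h5, ← h4, varSremp, varp, sremp, if_neg hp, mul_sub, h1, h2]
  rw [h6] at h3 ⊢
  rw [h6]
  linarith

end Sequences

/-! ### The Sturm–Tarski theorem and the Cauchy bound -/

section TarskiQueries

variable {R : Type u} [Field R] [LinearOrder R] [IsStrictOrderedRing R]

/-- If P = (X - c)^(k+1) g, then P' = (X - c)^k h with h(c) = (k+1) g(c), so g·h is positive at c.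
Hence P·P'·Q has odd multiplicity 2k+1 and the sign of Q(c) on the right when Q(c) ≠ 0; otherwise
the zero of Q raises the multiplicity of P'·Q to at least that of P. -/
theorem jump_derivative_mul {P : R[X]} (Q : R[X]) {c : R} (hP : P ≠ 0) (hc : P.eval c = 0) :
    jump P (derivative P * Q) c = 2 * intSign (Q.eval c) := by
  obtain ⟨g, hPg, hg⟩ := exists_eq_pow_mul_eval_ne_zero hP c
  obtain ⟨k, hk⟩ := Nat.exists_eq_succ_of_ne_zero
    ((rootMultiplicity_pos hP).mpr hc).ne'
  have hk' : P.rootMultiplicity c = k + 1 := hk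
  rw [hk'] at hPg
  obtain ⟨h, hh⟩ : ∃ h : R[X], h = C ((k : R) + 1) * g + (X - C c) * derivative g := ⟨_, rfl⟩
  have hhc : h.eval c = (k + 1) * g.eval c := by simp [hh]
  have hder : derivative P = (X - C c) ^ k * h := by
    rw [hPg, hh, derivative_mul, derivative_pow_succ]
    simp
    ring
  rcases eq_or_ne (Q.eval c) 0 with hQ | hQ
  · rw [hQ, intSign_zero, mul_zero]
    rcases eq_or_ne (derivative P * Q) 0 with h0 | h0
    · rw [h0, jump_zero_right]
    · refine if_neg (not_lt.mpr ?_)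
      rw [hk', le_rootMultiplicity_iff h0, hder, pow_succ]
      exact mul_dvd_mul (dvd_mul_right _ _) (dvd_iff_isRoot.mpr hQ)
  · have hk1 : (0 : R) < k + 1 := by positivity
    have hhQ : (h * Q).eval c ≠ 0 := by
      rw [eval_mul, hhc]
      exact mul_ne_zero (mul_ne_zero hk1.ne' hg) hQ
    have h1 : derivative P * Q = (X - C c) ^ k * (h * Q) := by rw [hder, mul_assoc]
    have h2 : P * (derivative P * Q) = (X - C c) ^ (2 * k + 1) * (g * (h * Q)) := by
      rw [h1]
      conv_lhs => rw [hPg]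
      ring
    have h3 : (g * (h * Q)).eval c ≠ 0 := by rw [eval_mul]; exact mul_ne_zero hg hhQ
    have h4 : intSign ((g * (h * Q)).eval c) = intSign (Q.eval c) := by
      simp only [eval_mul, hhc, intSign_mul, intSign_of_pos hk1]
      linear_combination intSign (Q.eval c) * intSign_mul_self hg
    rw [jump, h2, rightSign_pow_mul h3, leftSign_pow_mul h3, h4, h1, rootMultiplicity_pow_mul hhQ,
      if_pos (by rw [hk']; exact k.lt_succ_self), Odd.neg_one_pow ⟨k, rfl⟩]
    ring

/-- The Sturm–Tarski theorem. -/
theorem varSremp_derivative_mul [OrderedRealClosed R] {P : R[X]} (Q : R[X]) {a b : R}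
    (hab : a < b) (ha : P.eval a ≠ 0) (hb : P.eval b ≠ 0) :
    varSremp a b P (derivative P * Q) =
      ∑ c ∈ P.roots.toFinset.filter fun c => a < c ∧ c < b, intSign (Q.eval c) := by
  have hP : P ≠ 0 := by rintro rfl; exact ha eval_zero
  have h := two_mul_varSremp (derivative P * Q) hab ha hb
  rw [Finset.sum_congr rfl fun c hc => jump_derivative_mul Q hP (by
    simpa [hP] using (Finset.mem_filter.mp hc).1), ← Finset.mul_sum] at h
  linarith

theorem intSign_eq_of_abs_sub_lt {y z : R} (h : |y - z| < |z|) : intSign y = intSign z := by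
  rcases lt_trichotomy z 0 with hz | rfl | hz
  · rw [abs_of_neg hz, abs_lt] at h
    rw [intSign_of_neg hz, intSign_of_neg (by linarith)]
  · simp at h; exact absurd h (abs_nonneg y).not_gt
  · rw [abs_of_pos hz, abs_lt] at h
    rw [intSign_of_pos hz, intSign_of_pos (by linarith)]

theorem one_le_cauchyBound {S : R[X]} (hS : S ≠ 0) : 1 ≤ cauchyBound S := by
  have h0 : 0 < |S.leadingCoeff| := abs_pos.mpr (leadingCoeff_ne_zero.mpr hS)
  rw [cauchyBound, ← div_eq_inv_mul, one_le_div h0]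
  exact Finset.single_le_sum (f := fun i => |S.coeff i|) (fun i _ => abs_nonneg _)
    (Finset.self_mem_range_succ _)

/-- Beyond the Cauchy bound, the sign of a polynomial is that of its leading term. -/
theorem intSign_eval_of_cauchyBound_lt {S : R[X]} (hS : S ≠ 0) {x : R}
    (hx : cauchyBound S < |x|) :
    intSign (S.eval x) = intSign (S.leadingCoeff * x ^ S.natDegree) := by
  have h0 : 0 < |S.leadingCoeff| := abs_pos.mpr (leadingCoeff_ne_zero.mpr hS)
  have hx1 : 1 < |x| := (one_le_cauchyBound hS).trans_lt hx
  apply intSign_eq_of_abs_sub_lt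
  rw [eval_eq_sum_range, Finset.sum_range_succ, coeff_natDegree, add_sub_cancel_right, abs_mul,
    abs_pow]
  rw [cauchyBound, Finset.sum_range_succ, coeff_natDegree, ← div_eq_inv_mul, div_lt_iff₀ h0] at hx
  rcases hd : S.natDegree with _ | d
  -- In degree 0 there are no lower terms to bound.
  · simpa using h0
  rw [hd] at hx
  calc |∑ i ∈ Finset.range (d + 1), S.coeff i * x ^ i|
      ≤ ∑ i ∈ Finset.range (d + 1), |S.coeff i| * |x| ^ d := by
        refine (Finset.abs_sum_le_sum_abs _ _).trans (Finset.sum_le_sum fun i hi => ?_)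
        rw [abs_mul, abs_pow]
        exact mul_le_mul_of_nonneg_left
          (pow_le_pow_right₀ hx1.le (Nat.lt_succ_iff.mp (Finset.mem_range.mp hi))) (abs_nonneg _)
    _ = (∑ i ∈ Finset.range (d + 1), |S.coeff i|) * |x| ^ d := by rw [Finset.sum_mul]
    _ < (|x| * |S.leadingCoeff|) * |x| ^ d :=
        mul_lt_mul_of_pos_right (by linarith) (pow_pos (by linarith) _)
    _ = _ := by ring

theorem eval_ne_zero_of_cauchyBound_lt {S : R[X]} (hS : S ≠ 0) {x : R}
    (hx : cauchyBound S < |x|) : S.eval x ≠ 0 := by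
  intro h
  have hx0 : x ≠ 0 := by
    rintro rfl
    have := one_le_cauchyBound hS
    rw [abs_zero] at hx
    linarith
  have h1 := intSign_eval_of_cauchyBound_lt hS hx
  have h2 := intSign_mul_self (mul_ne_zero (leadingCoeff_ne_zero.mpr hS)
    (pow_ne_zero S.natDegree hx0))
  rw [← h1, h, intSign_zero] at h2
  simp at h2

end TarskiQueries

/-! ### Inverting the matrix of signs and exponents -/

section SignDetermination

theorem ctmat_apply {n : ℕ} (i j : Fin n → Fin 3) :
    ctmat n i j = ∏ k, ctmat1 (i k) (j k) := by
  induction n with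
  | zero => rw [Subsingleton.elim i j]; simp [ctmat]
  | succ n ih => simp [ctmat, Fin.prod_univ_succ, ih, Fin.tail]

theorem expPos_bijective : Function.Bijective expPos := by decide

variable {R : Type u} [Field R] [LinearOrder R]

/-- The row of `ctmat1` that belongs to the sign of an element. -/
def signRow (x : R) : Fin 3 := if 0 < x then 0 else if x < 0 then 1 else 2

theorem signRow_eq_zero_iff (x : R) : signRow x = 0 ↔ 0 < x := by
  unfold signRow
  split_ifs <;> simp_all

theorem intSign_pow_eq_ctmat1 (x : R) (e : Fin 3) :
    ((intSign x : ℤ) : ℚ) ^ (e : ℕ) = ctmat1 (signRow x) (expPos e) := by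
  rcases lt_trichotomy x 0 with h | rfl | h
  · have : signRow x = 1 := by simp [signRow, h, h.not_gt]
    rw [intSign_of_neg h, this]
    fin_cases e <;> simp [ctmat1, expPos]
  · have : signRow (0 : R) = 2 := by simp [signRow]
    rw [intSign_zero, this]
    fin_cases e <;> simp [ctmat1, expPos]
  · have : signRow x = 0 := by simp [signRow, h]
    rw [intSign_of_pos h, this]
    fin_cases e <;> simp [ctmat1, expPos]

variable [IsStrictOrderedRing R]

theorem intSign_prod_pow {n : ℕ} (y : Fin n → R) (ε : Fin n → Fin 3) :
    ((intSign (∏ k, y k ^ (ε k : ℕ)) : ℤ) : ℚ) =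
      ctmat n (fun k => signRow (y k)) fun k => expPos (ε k) := by
  have h : intSign (∏ k, y k ^ (ε k : ℕ)) = ∏ k, intSign (y k) ^ (ε k : ℕ) := by
    induction n with
    | zero => simp [intSign]
    | succ n ih => rw [Fin.prod_univ_succ, Fin.prod_univ_succ, intSign_mul, intSign_pow, ih]
  rw [h, ctmat_apply]
  push_cast
  exact Finset.prod_congr rfl fun k _ => intSign_pow_eq_ctmat1 _ _

/-- The sum is an entry of `ctmat n * (ctmat n)⁻¹ = 1`, in the row of the signs of y and the column
of (1, …, 1). -/
theorem sum_lam_mul_intSign {n : ℕ} (y : Fin n → R) :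
    ∑ ε : Fin n → Fin 3, lam ε * ((intSign (∏ k, y k ^ (ε k : ℕ)) : ℤ) : ℚ) =
      if ∀ k, 0 < y k then 1 else 0 := by
  have hbij : Function.Bijective fun (ε : Fin n → Fin 3) k => expPos (ε k) :=
    expPos_bijective.comp_left
  have h : ∑ ε : Fin n → Fin 3, lam ε * ((intSign (∏ k, y k ^ (ε k : ℕ)) : ℤ) : ℚ) =
      (ctmat n * (ctmat n)⁻¹) (fun k => signRow (y k)) fun _ => 0 := by
    rw [Matrix.mul_apply, ← hbij.sum_comp fun e => ctmat n (fun k => signRow (y k)) e * _]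
    refine Finset.sum_congr rfl fun ε _ => ?_
    rw [intSign_prod_pow, lam, mul_comm]
  rw [h, Matrix.mul_nonsing_inv _ (isUnit_det_ctmat n), Matrix.one_apply]
  simp only [funext_iff, signRow_eq_zero_iff]

end SignDetermination

/-! ### The decision sum as a number of roots -/

section DecisionSum

variable {R : Type u} [Field R] [LinearOrder R] [IsStrictOrderedRing R] [OrderedRealClosed R]
  {n : ℕ}

/-- The decision sum counts the roots at which all `Qₖ` are positive. -/
theorem decisionSum_eq_card {P : R[X]} (hP : P ≠ 0) (Q : Fin n → R[X]) {b : R}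
    (hb : cauchyBound P < b) :
    decisionSum b P Q =
      ((P.roots.toFinset.filter fun c => ∀ k, 0 < (Q k).eval c).card : ℚ) := by
  have h0 : 0 < b := by linarith [one_le_cauchyBound hP]
  have h1 : P.eval b ≠ 0 := eval_ne_zero_of_cauchyBound_lt hP (by rwa [abs_of_pos h0])
  have h2 : P.eval (-b) ≠ 0 :=
    eval_ne_zero_of_cauchyBound_lt hP (by rwa [abs_neg, abs_of_pos h0])
  have hroots : (P.roots.toFinset.filter fun c => -b < c ∧ c < b) = P.roots.toFinset := by
    refine Finset.filter_true_of_mem fun c hc => abs_lt.mp ?_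
    by_contra h
    exact eval_ne_zero_of_cauchyBound_lt hP (hb.trans_le (not_lt.mp h)) (by simpa [hP] using hc)
  rw [decisionSum, Finset.card_filter]
  simp only [taqPoly]
  calc _ = ∑ ε : Fin n → Fin 3, ∑ c ∈ P.roots.toFinset,
        lam ε * ((intSign (∏ k, (Q k).eval c ^ (ε k : ℕ)) : ℤ) : ℚ) := by
        refine Finset.sum_congr rfl fun ε _ => ?_
        rw [varSremp_derivative_mul _ (by linarith) h2 h1, hroots, Int.cast_sum, Finset.mul_sum]
        simp only [eval_prod, eval_pow]
    _ = _ := by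
        rw [Finset.sum_comm, Nat.cast_sum]
        refine Finset.sum_congr rfl fun c _ => ?_
        rw [sum_lam_mul_intSign]
        split_ifs <;> simp

theorem exists_root_iff_decisionSum_pos {P : R[X]} (hP : P ≠ 0) (Q : Fin n → R[X]) {b : R}
    (hb : cauchyBound P < b) :
    (∃ x : R, P.eval x = 0 ∧ ∀ k, 0 < (Q k).eval x) ↔ 0 < decisionSum b P Q := by
  rw [decisionSum_eq_card hP Q hb, Nat.cast_pos, Finset.card_pos]
  simp only [Finset.Nonempty, Finset.mem_filter, Multiset.mem_toFinset, mem_roots hP, IsRoot.def]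

end DecisionSum

/-! ### Existence of admissible bounds -/

section Bounds

variable {R : Type u} [Field R] [LinearOrder R] [IsStrictOrderedRing R] {n : ℕ}

/-- Some `b` is beyond the Cauchy bounds of all polynomials in the remainder sequences. -/
theorem exists_cauchyBound_lt (P : R[X]) (Q : Fin n → R[X]) :
    ∃ b : R, cauchyBound P < b ∧
      ∀ ε : Fin n → Fin 3, ∀ S ∈ sremp P (taqPoly P Q ε), cauchyBound S < b := by
  classical
  obtain ⟨M, hM⟩ := (insert P (Finset.univ.biUnion fun ε : Fin n → Fin 3 =>
    (sremp P (taqPoly P Q ε)).toFinset)).image cauchyBound |>.bddAbove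
  refine ⟨M + 1, ?_, fun ε S hS => ?_⟩
  · refine (hM ?_).trans_lt (lt_add_one M)
    simp
  · refine (hM ?_).trans_lt (lt_add_one M)
    simp only [Finset.coe_image, Set.mem_image]
    refine ⟨S, ?_, rfl⟩
    simp only [Finset.mem_coe, Finset.mem_insert, Finset.mem_biUnion, List.mem_toFinset]
    exact Or.inr ⟨ε, Finset.mem_univ _, hS⟩

theorem isAdmissibleBound_of_cauchyBound_lt {P : R[X]} {Q : Fin n → R[X]} {b : R}
    (hb : cauchyBound P < b)
    (h : ∀ ε : Fin n → Fin 3, ∀ S ∈ sremp P (taqPoly P Q ε), cauchyBound S < b) :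
    IsAdmissibleBound P Q b := by
  refine ⟨hb, fun ε S hS => eval_ne_zero_of_cauchyBound_lt (ne_zero_of_mem_sremp S hS) ?_⟩
  exact (h ε S hS).trans_le (le_abs_self b)

end Bounds

/-! ### Decision trees and their translation into formulas -/

section SignTrees

/-- Decision trees that branch on the signs of polynomials with integer coefficients. -/
inductive SignTree (σ α : Type) : Type
  | leaf (a : α) : SignTree σ α
  | node (f : MvPolynomial σ ℤ) (neg zero pos : SignTree σ α) : SignTree σ α

namespace SignTree

variable {σ α β : Type}

/-- The leaf that is reached at the values `v` of the variables. -/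
noncomputable def eval {R : Type u} [Field R] [LinearOrder R] (v : σ → R) : SignTree σ α → α
  | leaf a => a
  | node f s t w =>
      if MvPolynomial.aeval v f < 0 then s.eval v
      else if MvPolynomial.aeval v f = 0 then t.eval v else w.eval v

/-- Replaces each leaf by a tree. -/
def bind (k : α → SignTree σ β) : SignTree σ α → SignTree σ β
  | leaf a => k a
  | node f s t w => node f (s.bind k) (t.bind k) (w.bind k)

theorem eval_bind {R : Type u} [Field R] [LinearOrder R] (v : σ → R) (k : α → SignTree σ β)
    (t : SignTree σ α) : (t.bind k).eval v = (k (t.eval v)).eval v := by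
  induction t with
  | leaf a => rfl
  | node f s t w hs ht hw =>
    simp only [bind, eval]
    split_ifs <;> assumption

/-- Each branch is guarded by its own sign condition, and exactly one guard holds. The formula is
built from the tree alone, hence is the same for all fields. -/
theorem exists_signFormula (t : SignTree σ α) (p : α → Prop) :
    ∃ φ : SignFormula σ, ∀ (R : Type u) [Field R] [LinearOrder R] [IsStrictOrderedRing R]
      (v : σ → R), p (t.eval v) ↔ φ.Holds v := by
  induction t with
  | leaf a =>
    by_cases h : p a
    · exact ⟨.zero 0, fun R _ _ _ v => by simp [eval, SignFormula.Holds, h]⟩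
    · exact ⟨.zero 1, fun R _ _ _ v => by simp [eval, SignFormula.Holds, h]⟩
  | node f s t w hs ht hw =>
    obtain ⟨φ, hφ⟩ := hs
    obtain ⟨ψ, hψ⟩ := ht
    obtain ⟨χ, hχ⟩ := hw
    refine ⟨.or (.and (.pos (-f)) φ) (.or (.and (.zero f) ψ) (.and (.pos f) χ)),
      fun R _ _ _ v => ?_⟩
    simp only [eval, SignFormula.Holds, ← hφ R v, ← hψ R v, ← hχ R v, map_neg, neg_pos]
    rcases lt_trichotomy (MvPolynomial.aeval v f) 0 with h | h | h
    · simp [h, h.ne, h.not_gt]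
    · simp [h]
    · simp [h, h.ne', h.not_gt]

theorem exists_eval_eq_intSign (l : List (MvPolynomial σ ℤ)) :
    ∃ t : SignTree σ (List ℤ), ∀ (R : Type u) [Field R] [LinearOrder R] [IsStrictOrderedRing R]
      (v : σ → R), t.eval v = l.map fun f => intSign (MvPolynomial.aeval v f) := by
  induction l with
  | nil => exact ⟨leaf [], fun R _ _ _ v => rfl⟩
  | cons f l ih =>
    obtain ⟨t, ht⟩ := ih
    refine ⟨t.bind fun s => node f (leaf (-1 :: s)) (leaf (0 :: s)) (leaf (1 :: s)),
      fun R _ _ _ v => ?_⟩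
    rw [eval_bind, ht R v]
    simp only [eval, List.map_cons]
    rcases lt_trichotomy (MvPolynomial.aeval v f) 0 with h | h | h
    · rw [if_pos h, intSign_of_neg h]
    · rw [h, if_neg (lt_irrefl _), if_pos rfl, intSign_zero]
    · rw [if_neg h.not_gt, if_neg h.ne', intSign_of_pos h]

theorem exists_eval_eq_sum {ι : Type} (s : Finset ι) (a : ι → ℚ) (t : ι → SignTree σ ℤ) :
    ∃ w : SignTree σ ℚ, ∀ (R : Type u) [Field R] [LinearOrder R] (v : σ → R),
      w.eval v = ∑ i ∈ s, a i * (((t i).eval v : ℤ) : ℚ) := by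
  classical
  induction s using Finset.induction_on with
  | empty => exact ⟨leaf 0, fun R _ _ v => by simp [eval]⟩
  | insert i s hi ih =>
    obtain ⟨w, hw⟩ := ih
    refine ⟨w.bind fun x => (t i).bind fun y : ℤ => leaf (a i * (y : ℚ) + x), fun R _ _ v => ?_⟩
    rw [Finset.sum_insert hi, eval_bind, eval_bind, hw R v, eval]

end SignTree

end SignTrees

/-! ### Sign changes depend on signs only -/

section SignVariations

/-- Number of sign changes in a list of integers. -/
def signVar (s : List ℤ) : ℕ := var (s.map fun x : ℤ => (x : ℚ))

variable {R : Type u} [Field R] [LinearOrder R]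

theorem intSign_lt_zero_iff {x : R} : intSign x < 0 ↔ x < 0 := by
  rcases lt_trichotomy x 0 with h | rfl | h
  · simp [intSign_of_neg h, h]
  · simp
  · simp [intSign_of_pos h, h.le]

theorem intSign_eq_zero_iff {x : R} : intSign x = 0 ↔ x = 0 := by
  rcases lt_trichotomy x 0 with h | rfl | h
  · simp [intSign_of_neg h, h.ne]
  · simp
  · simp [intSign_of_pos h, h.ne']

variable [IsStrictOrderedRing R]

theorem oppositeNeighbours_map_intSign (s : List R) :
    oppositeNeighbours (s.map fun x => ((intSign x : ℤ) : ℚ)) = oppositeNeighbours s := by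
  induction s with
  | nil => rfl
  | cons a s ih =>
    have h : (s.map fun x => ((intSign x : ℤ) : ℚ)).headD 0 = ((intSign (s.headD 0) : ℤ) : ℚ) := by
      cases s <;> simp
    simp only [List.map_cons, oppositeNeighbours, ih, h]
    rw [← Int.cast_mul, ← intSign_mul]
    simp only [Int.cast_lt_zero, intSign_lt_zero_iff]

theorem signVar_map_intSign (s : List R) : signVar (s.map intSign) = var s := by
  rw [signVar, var, var, List.map_map, List.filter_map, Function.comp_def, Function.comp_def,
    oppositeNeighbours_map_intSign]
  congr 2
  funext x
  simp [intSign_eq_zero_iff]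

end SignVariations

/-! ### Pseudo-division with indeterminate coefficients -/

section GenericPolynomials

/-- Pseudo-division over a ring: each factor of the leading coefficient pays for cancelling one top
coefficient. Since k only bounds the number of steps, superfluous factors do no harm. -/
theorem exists_pow_leadingCoeff_mul_eq {A : Type*} [CommRing A] (q : A[X]) (k : ℕ) :
    ∀ p : A[X], p.degree < (q.natDegree + k : ℕ) →
      ∃ w r : A[X], C (q.leadingCoeff ^ k) * p = w * q + r ∧ r.degree < (q.natDegree : ℕ) := by
  induction k with
  | zero => exact fun p hp => ⟨0, p, by simp, hp⟩
  | succ k ih =>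
    intro p hp
    rw [degree_lt_iff_coeff_zero] at hp
    obtain ⟨w, r, h, hr⟩ := ih
      (C q.leadingCoeff * p - C (p.coeff (q.natDegree + k)) * q * X ^ k) (by
        rw [degree_lt_iff_coeff_zero]
        intro m hm
        rw [coeff_sub, coeff_C_mul, coeff_mul_X_pow', if_pos (by omega), coeff_C_mul]
        rcases hm.eq_or_lt with rfl | hm
        · rw [Nat.add_sub_cancel, coeff_natDegree]; ring
        · rw [hp m hm, coeff_eq_zero_of_natDegree_lt (p := q) (by omega)]; ring)
    refine ⟨w + C (q.leadingCoeff ^ k) * C (p.coeff (q.natDegree + k)) * X ^ k, r, ?_, hr⟩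
    rw [pow_succ, C_mul]
    linear_combination h

variable {σ : Type} {R : Type u} [Field R]

/-- The polynomial obtained by giving values to the variables in the coefficients. -/
noncomputable def specialize (v : σ → R) (p : (MvPolynomial σ ℤ)[X]) : R[X] :=
  p.map (MvPolynomial.aeval v : MvPolynomial σ ℤ →ₐ[ℤ] R).toRingHom

theorem eval_specialize (v : σ → R) (p : (MvPolynomial σ ℤ)[X]) (f : MvPolynomial σ ℤ) :
    (specialize v p).eval (MvPolynomial.aeval v f) = MvPolynomial.aeval v (p.eval f) := by
  rw [specialize, eval_map]
  exact eval₂_at_apply (MvPolynomial.aeval v : MvPolynomial σ ℤ →ₐ[ℤ] R).toRingHom f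

theorem natDegree_specialize {v : σ → R} {p : (MvPolynomial σ ℤ)[X]}
    (h : MvPolynomial.aeval v p.leadingCoeff ≠ 0) :
    (specialize v p).natDegree = p.natDegree :=
  natDegree_map_of_leadingCoeff_ne_zero _ h

theorem leadingCoeff_specialize {v : σ → R} {p : (MvPolynomial σ ℤ)[X]}
    (h : MvPolynomial.aeval v p.leadingCoeff ≠ 0) :
    (specialize v p).leadingCoeff = MvPolynomial.aeval v p.leadingCoeff :=
  leadingCoeff_map_of_leadingCoeff_ne_zero _ h

theorem specialize_ne_zero {v : σ → R} {p : (MvPolynomial σ ℤ)[X]}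
    (h : MvPolynomial.aeval v p.leadingCoeff ≠ 0) : specialize v p ≠ 0 := by
  rw [← leadingCoeff_ne_zero, leadingCoeff_specialize h]
  exact h

/-- This lets the degree drop in the branch where the leading coefficient vanishes. -/
theorem specialize_eraseLead {v : σ → R} {p : (MvPolynomial σ ℤ)[X]}
    (h : MvPolynomial.aeval v p.leadingCoeff = 0) :
    specialize v p.eraseLead = specialize v p := by
  have h' : (MvPolynomial.aeval v : MvPolynomial σ ℤ →ₐ[ℤ] R).toRingHom p.leadingCoeff = 0 := h
  conv_rhs => rw [specialize, ← eraseLead_add_C_mul_X_pow p, Polynomial.map_add,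
    Polynomial.map_mul, map_C, h', C_0, zero_mul, add_zero]
  rfl

/-- Nonvanishing leading coefficients preserve degrees, hence the exponent in `scal`; the
specialized pseudo-division is then a Euclidean division, whose remainder is unique. The polynomial
r is found before the field and the values. -/
theorem exists_specialize_eq_neg_pseudoMod (p : (MvPolynomial σ ℤ)[X])
    {q : (MvPolynomial σ ℤ)[X]} (hq : q ≠ 0) :
    ∃ r : (MvPolynomial σ ℤ)[X], r.degree < q.degree ∧
      ∀ (R : Type u) [Field R] (v : σ → R), MvPolynomial.aeval v p.leadingCoeff ≠ 0 →
        MvPolynomial.aeval v q.leadingCoeff ≠ 0 →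
        -pseudoMod (specialize v p) (specialize v q) = specialize v r := by
  -- The exponent is that of `scal`. If deg p < deg q, truncated subtraction makes it 0 and p is
  -- already reduced.
  obtain ⟨w, r, h, hr⟩ := exists_pow_leadingCoeff_mul_eq q
    (2 * (p.natDegree + 1 - q.natDegree)) p
    (degree_le_natDegree.trans_lt (by exact_mod_cast (by omega)))
  rw [← degree_eq_natDegree hq] at hr
  refine ⟨-r, by rwa [degree_neg], fun R _ v hpv hqv => ?_⟩
  have hq0 := specialize_ne_zero hqv
  have h' := congrArg (specialize v) h
  have hs : specialize v (C (q.leadingCoeff ^ (2 * (p.natDegree + 1 - q.natDegree))) * p) =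
      C (scal (specialize v p) (specialize v q)) * specialize v p := by
    rw [scal, natDegree_specialize hpv, natDegree_specialize hqv, leadingCoeff_specialize hqv]
    simp [specialize]
  have hw : specialize v (w * q + r) = specialize v w * specialize v q + specialize v r := by
    simp [specialize]
  have hneg : specialize v (-r) = -specialize v r := by simp [specialize]
  have hdeg : (specialize v r).degree < (specialize v q).degree := by
    rw [degree_eq_natDegree hq0, natDegree_specialize hqv, ← degree_eq_natDegree hq]
    exact degree_map_le.trans_lt hr
  rw [hs, hw] at h'
  rw [pseudoMod, h', add_mod, hneg, (mod_eq_self_iff hq0).mpr hdeg,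
    EuclideanDomain.mod_eq_zero.mpr (dvd_mul_left _ _), zero_add]

/-- The remainder sequence of polynomials with indeterminate coefficients is computed by a
decision tree. -/
theorem exists_signTree_srempFrom (q : (MvPolynomial σ ℤ)[X]) :
    ∀ p : (MvPolynomial σ ℤ)[X], ∃ t : SignTree σ (List (MvPolynomial σ ℤ)[X]),
      ∀ (R : Type u) [Field R] [LinearOrder R] [IsStrictOrderedRing R] (v : σ → R),
        MvPolynomial.aeval v p.leadingCoeff ≠ 0 →
        srempFrom (specialize v p) (specialize v q) = (t.eval v).map (specialize v) ∧
          ∀ f ∈ t.eval v, MvPolynomial.aeval v f.leadingCoeff ≠ 0 := by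
  induction hd : q.degree using WellFoundedLT.induction generalizing q with
  | ind d ih =>
    intro p
    subst hd
    rcases eq_or_ne q 0 with rfl | hq
    · refine ⟨.leaf [p], fun R _ _ _ v hp => ?_⟩
      have : specialize v (0 : (MvPolynomial σ ℤ)[X]) = 0 := by simp [specialize]
      simpa [this, srempFrom_zero, SignTree.eval] using hp
    · obtain ⟨r, hrq, hr⟩ := exists_specialize_eq_neg_pseudoMod.{u} p hq
      obtain ⟨t₀, ht₀⟩ := ih _ (degree_eraseLead_lt hq) _ rfl p
      obtain ⟨t₁, ht₁⟩ := ih _ hrq _ rfl q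
      refine ⟨.node q.leadingCoeff (t₁.bind fun l => .leaf (p :: l)) t₀
        (t₁.bind fun l => .leaf (p :: l)), fun R _ _ _ v hp => ?_⟩
      by_cases hv : MvPolynomial.aeval v q.leadingCoeff = 0
      · simpa [SignTree.eval, hv, specialize_eraseLead hv] using ht₀ R v hp
      · obtain ⟨h1, h2⟩ := ht₁ R v hv
        simp only [SignTree.eval, hv, if_false, SignTree.eval_bind, ite_self]
        rw [srempFrom_of_ne_zero _ (specialize_ne_zero hv), hr R v hp hv, h1]
        exact ⟨rfl, List.forall_mem_cons.mpr ⟨hp, h2⟩⟩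

/-- The monic polynomial of degree `d` with indeterminate coefficients. -/
noncomputable def genericMonic (x : ℕ → σ) (d : ℕ) : (MvPolynomial σ ℤ)[X] :=
  X ^ d + ∑ i ∈ Finset.range d, C (MvPolynomial.X (x i)) * X ^ i

/-- The polynomial of degree at most `e` with indeterminate coefficients. -/
noncomputable def genericPoly (x : ℕ → σ) (e : ℕ) : (MvPolynomial σ ℤ)[X] :=
  ∑ i ∈ Finset.range (e + 1), C (MvPolynomial.X (x i)) * X ^ i

theorem monic_genericMonic (x : ℕ → σ) (d : ℕ) : (genericMonic x d).Monic := by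
  refine monic_X_pow_add ?_
  rw [degree_lt_iff_coeff_zero]
  intro m hm
  rw [finsetSum_coeff]
  refine Finset.sum_eq_zero fun i hi => ?_
  rw [coeff_C_mul, coeff_X_pow, if_neg (by have := Finset.mem_range.mp hi; omega), mul_zero]

theorem specialize_genericMonic {x : ℕ → σ} {v : σ → R} {P : R[X]} (hP : P.Monic)
    (h : ∀ i, v (x i) = P.coeff i) : specialize v (genericMonic x P.natDegree) = P := by
  conv_rhs => rw [hP.as_sum]
  simp [specialize, genericMonic, Polynomial.map_sum, h]

theorem specialize_genericPoly {x : ℕ → σ} {v : σ → R} {Q : R[X]} {e : ℕ}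
    (hQ : Q.natDegree ≤ e) (h : ∀ i, v (x i) = Q.coeff i) :
    specialize v (genericPoly x e) = Q := by
  conv_rhs => rw [Q.as_sum_range' (e + 1) (Nat.lt_succ_of_le hQ)]
  simp [specialize, genericPoly, Polynomial.map_sum, h, C_mul_X_pow_eq_monomial]

end GenericPolynomials

/-! ### The formulas Ψ and Φ -/

section Formulas

variable {σ : Type} {n : ℕ}

theorem exists_signTree_srempFrom_taqPoly (x : CoeffVar n → σ) (d e : ℕ) (ε : Fin n → Fin 3) :
    ∃ t : SignTree σ (List (MvPolynomial σ ℤ)[X]),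
      ∀ (R : Type u) [Field R] [LinearOrder R] [IsStrictOrderedRing R] (v : σ → R) (P : R[X])
        (Q : Fin n → R[X]), P.Monic → P.natDegree = d → (∀ k, (Q k).natDegree ≤ e) →
        (∀ c, v (x c) = coeffVal P Q c) →
        sremp P (taqPoly P Q ε) = (t.eval v).map (specialize v) ∧
          ∀ f ∈ t.eval v, MvPolynomial.aeval v f.leadingCoeff ≠ 0 := by
  obtain ⟨p, hp⟩ : ∃ p, p = genericMonic (fun i => x (.ofP i)) d := ⟨_, rfl⟩
  obtain ⟨t, ht⟩ := exists_signTree_srempFrom.{u}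
    (derivative p * ∏ k, genericPoly (fun i => x (.ofQ k i)) e ^ (ε k : ℕ)) p
  refine ⟨t, fun R _ _ _ v P Q hP hd hQ hv => ?_⟩
  have hpP : specialize v p = P := by
    rw [hp, ← hd]; exact specialize_genericMonic hP fun i => hv _
  have hqQ : ∀ k, specialize v (genericPoly (fun i => x (.ofQ k i)) e) = Q k := fun k =>
    specialize_genericPoly (hQ k) fun i => hv _
  have h := ht R v (by rw [hp, (monic_genericMonic _ d).leadingCoeff, map_one]; exact one_ne_zero)
  have htaq : specialize v
      (derivative p * ∏ k, genericPoly (fun i => x (.ofQ k i)) e ^ (ε k : ℕ)) =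
      taqPoly P Q ε := by
    simp only [taqPoly, ← hpP, ← hqQ]
    simp only [specialize, Polynomial.map_mul, Polynomial.map_prod, Polynomial.map_pow,
      derivative_map]
  rwa [htaq, hpP, ← if_neg (c := P = 0) (t := []) (e := srempFrom P _) hP.ne_zero] at h

/-- The decision sum in which the values at the end points are replaced by the values of
polynomial expressions `g` and `h` in the coefficients of the remainders. -/
theorem exists_signTree_decisionSum (x : CoeffVar n → σ) (d e : ℕ)
    (g h : (MvPolynomial σ ℤ)[X] → MvPolynomial σ ℤ) :
    ∃ t : SignTree σ ℚ,
      ∀ (R : Type u) [Field R] [LinearOrder R] [IsStrictOrderedRing R] (v : σ → R) (P : R[X])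
        (Q : Fin n → R[X]) (b : R), P.Monic → P.natDegree = d → (∀ k, (Q k).natDegree ≤ e) →
        (∀ c, v (x c) = coeffVal P Q c) →
        (∀ ε : Fin n → Fin 3, ∀ f : (MvPolynomial σ ℤ)[X],
          specialize v f ∈ sremp P (taqPoly P Q ε) → MvPolynomial.aeval v f.leadingCoeff ≠ 0 →
          intSign ((specialize v f).eval (-b)) = intSign (MvPolynomial.aeval v (g f)) ∧
          intSign ((specialize v f).eval b) = intSign (MvPolynomial.aeval v (h f))) →
        t.eval v = decisionSum b P Q := by
  choose t ht using exists_signTree_srempFrom_taqPoly.{u} x d e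
  choose s hs using SignTree.exists_eval_eq_intSign.{u} (σ := σ)
  obtain ⟨w, hw⟩ := SignTree.exists_eval_eq_sum.{u} Finset.univ lam fun ε =>
    (t ε).bind fun l => (s (l.map g)).bind fun y => (s (l.map h)).bind fun z =>
      .leaf ((signVar y : ℤ) - (signVar z : ℤ))
  refine ⟨w, fun R _ _ _ v P Q b hP hd hQ hv hgh => ?_⟩
  rw [hw R v, decisionSum]
  refine Finset.sum_congr rfl fun ε _ => ?_
  obtain ⟨h1, h2⟩ := ht ε R v P Q hP hd hQ hv
  have h3 : ∀ f ∈ (t ε).eval v,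
      intSign ((specialize v f).eval (-b)) = intSign (MvPolynomial.aeval v (g f)) ∧
      intSign ((specialize v f).eval b) = intSign (MvPolynomial.aeval v (h f)) := fun f hf =>
    hgh ε f (h1 ▸ List.mem_map_of_mem hf) (h2 f hf)
  simp only [SignTree.eval_bind, hs _ R v, SignTree.eval]
  rw [varSremp, varp, h1, ← signVar_map_intSign, ← signVar_map_intSign]
  simp only [List.map_map, Function.comp_def]
  rw [List.map_congr_left fun f hf => (h3 f hf).1, List.map_congr_left fun f hf => (h3 f hf).2]

theorem exists_formula_decisionSum_pos (n d e : ℕ) :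
    ∃ Ψ : SignFormula (Option (CoeffVar n)),
      ∀ (R : Type u) [Field R] [LinearOrder R] [IsStrictOrderedRing R] (P : R[X])
        (Q : Fin n → R[X]) (b : R), P.Monic → P.natDegree = d → (∀ k, (Q k).natDegree ≤ e) →
        (0 < decisionSum b P Q ↔ Ψ.Holds (boundCoeffVal b P Q)) := by
  -- The variable `none` stands for b, so the remainders are evaluated symbolically at -b and b.
  obtain ⟨t, ht⟩ := exists_signTree_decisionSum.{u} (n := n) some d e
    (fun f => f.eval (-MvPolynomial.X none)) fun f => f.eval (MvPolynomial.X none)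
  obtain ⟨Ψ, hΨ⟩ := t.exists_signFormula.{u} (0 < ·)
  refine ⟨Ψ, fun R _ _ _ P Q b hP hd hQ => ?_⟩
  rw [← hΨ, ht R (boundCoeffVal b P Q) P Q b hP hd hQ fun c => rfl]
  intro ε f _ _
  rw [← eval_specialize, ← eval_specialize]
  simp [boundCoeffVal]

theorem exists_formula_exists_root (n d e : ℕ) :
    ∃ Φ : SignFormula (CoeffVar n),
      ∀ (R : Type u) [Field R] [LinearOrder R] [IsStrictOrderedRing R] [OrderedRealClosed R]
        (P : R[X]) (Q : Fin n → R[X]), P.Monic → P.natDegree = d → (∀ k, (Q k).natDegree ≤ e) →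
        ((∃ x : R, P.eval x = 0 ∧ ∀ k, 0 < (Q k).eval x) ↔ Φ.Holds (coeffVal P Q)) := by
  -- These are the signs at -b and b for b beyond all Cauchy bounds; they do not involve b.
  obtain ⟨t, ht⟩ := exists_signTree_decisionSum.{u} (n := n) id d e
    (fun f => (-1) ^ f.natDegree * f.leadingCoeff) fun f => f.leadingCoeff
  obtain ⟨Φ, hΦ⟩ := t.exists_signFormula.{u} (0 < ·)
  refine ⟨Φ, fun R _ _ _ _ P Q hP hd hQ => ?_⟩
  obtain ⟨b, hb, hbS⟩ := exists_cauchyBound_lt P Q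
  have hb0 : 0 < b := by linarith [one_le_cauchyBound hP.ne_zero]
  rw [exists_root_iff_decisionSum_pos hP.ne_zero Q hb, ← hΦ,
    ht R (coeffVal P Q) P Q b hP hd hQ fun c => rfl]
  intro ε f hf hlc
  have hS := hbS ε _ hf
  have hS0 := specialize_ne_zero hlc
  rw [intSign_eval_of_cauchyBound_lt hS0 (by rwa [abs_neg, abs_of_pos hb0]),
    intSign_eval_of_cauchyBound_lt hS0 (by rwa [abs_of_pos hb0]), leadingCoeff_specialize hlc,
    natDegree_specialize hlc, neg_pow, map_mul, map_pow, map_neg, map_one]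
  simp only [intSign_mul, intSign_pow b, intSign_of_pos hb0, one_pow, mul_one]
  exact ⟨mul_comm _ _, trivial⟩

end Formulas

end TarskiQuery

theorem mainTheorem3 (n : ℕ) :
    (∀ (R : Type u) [Field R] [LinearOrder R] [IsStrictOrderedRing R] [OrderedRealClosed R]
        (P : R[X]) (Q : Fin n → R[X]), P.Monic →
      (∃ b : R, TarskiQuery.IsAdmissibleBound P Q b) ∧
      ∀ b : R, TarskiQuery.IsAdmissibleBound P Q b →
        ((∃ x : R, P.eval x = 0 ∧ ∀ k, 0 < (Q k).eval x) ↔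
          0 < TarskiQuery.decisionSum b P Q)) ∧
    (∀ d e : ℕ,
      ∃ (Ψ : TarskiQuery.SignFormula (Option (TarskiQuery.CoeffVar n)))
        (Φ : TarskiQuery.SignFormula (TarskiQuery.CoeffVar n)),
      ∀ (R : Type u) [Field R] [LinearOrder R] [IsStrictOrderedRing R] [OrderedRealClosed R]
        (P : R[X]) (Q : Fin n → R[X]), P.Monic → P.natDegree = d →
        (∀ k, (Q k).natDegree ≤ e) →
        (∀ b : R, 0 < TarskiQuery.decisionSum b P Q ↔
          Ψ.Holds (TarskiQuery.boundCoeffVal b P Q)) ∧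
        ((∃ x : R, P.eval x = 0 ∧ ∀ k, 0 < (Q k).eval x) ↔
          Φ.Holds (TarskiQuery.coeffVal P Q))) := by
  refine ⟨fun R _ _ _ _ P Q hP => ⟨?_, fun b hb =>
    TarskiQuery.exists_root_iff_decisionSum_pos hP.ne_zero Q hb.1⟩, fun d e => ?_⟩
  · obtain ⟨b, hb, h⟩ := TarskiQuery.exists_cauchyBound_lt P Q
    exact ⟨b, TarskiQuery.isAdmissibleBound_of_cauchyBound_lt hb h⟩
  · obtain ⟨Ψ, hΨ⟩ := TarskiQuery.exists_formula_decisionSum_pos.{u} n d e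
    obtain ⟨Φ, hΦ⟩ := TarskiQuery.exists_formula_exists_root.{u} n d e
    exact ⟨Ψ, Φ, fun R _ _ _ _ P Q hP hd hQ =>
      ⟨fun b => hΨ R P Q b hP hd hQ, hΦ R P Q hP hd hQ⟩⟩
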